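/- Let $\mathcal G$ be a non-empty ample groupoid, i.e. a topological groupoid (not necessarily Hausdorff) whose unit space $\mathcal G^{(0)}$ is locally compact, Hausdorff and totally disconnected and whose source and range maps $s,r\colon\mathcal G\to\mathcal G^{(0)}$ are local homeomorphisms. Let $\mathcal T\subseteq\mathcal G^{(0)}$ be the set of units with trivial isotropy group. Assume that $\mathcal G$ is topologically principal ($\mathcal T$ is dense in $\mathcal G^{(0)}$) and minimal (the only open subsets $D\subseteq\mathcal G^{(0)}$ such that $s(\gamma)\in D$ implies $r(\gamma)\in D$ for all $\gamma\in\mathcal G$ are $\varnothing$ and $\mathcal G^{(0)}$). Let $S$ be a semifield, i.e. a nontrivial commutative semiring in which every nonzero element has a multiplicative inverse. Let $A_S(\mathcal G)$ be the Steinberg algebra: the $S$-submodule of $S^{\mathcal G}$ generated by the characteristic functions of compact open bisections (subsets $U\subseteq\mathcal G$ on which $s$ and $r$ restrict to homeomorphisms onto their images), with the convolution product $(f*g)(\gamma)=\sum_{\alpha\beta=\gamma}f(\alpha)g(\beta)$. Let $\equiv$ be the congruence on $A_S(\mathcal G)$ given by $f\equiv g$ if and only if $f(\alpha)=g(\alpha)$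 for all $\alpha\in\mathcal G$ with $s(\alpha),r(\alpha)\in\mathcal T$. Then the quotient $A_S(\mathcal G)/{\equiv}$ is congruence-simple (its only congruences, i.e. equivalence relations compatible with addition and multiplication, are the diagonal one and the full one) if and only if $S$ is either a field or isomorphic to the Boolean semifield $\mathbb B=(\{0,1\},\mathrm{or},\mathrm{and})$. -/

import Mathlib

open CategoryTheory

universe u v w

/-! ### The Boolean semifield -/

/-- The Boolean semifield `({0, 1}, or, and)`. -/
def BoolSemifield : Type := Bool

namespace BoolSemifield

instance : Semifield BoolSemifield where
  add a b := Bool.or a b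
  zero := false
  mul a b := Bool.and a b
  one := true
  inv a := a
  nsmul n a := @nsmulRec Bool ⟨false⟩ ⟨Bool.or⟩ n a
  nnqsmul := _
  nnqsmul_def _ _ := rfl
  add_assoc := Bool.or_assoc
  zero_add := Bool.false_or
  add_zero := Bool.or_false
  add_comm := Bool.or_comm
  left_distrib := Bool.and_or_distrib_left
  right_distrib := Bool.and_or_distrib_right
  zero_mul := Bool.false_and
  mul_zero := Bool.and_false
  mul_assoc := Bool.and_assoc
  one_mul := Bool.true_and
  mul_one := Bool.and_true
  mul_comm := Bool.and_comm
  exists_pair_ne := ⟨false, true, Bool.false_ne_true⟩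
  inv_zero := rfl
  mul_inv_cancel a ha := by
    cases a with
    | false => exact absurd rfl ha
    | true => rfl

end BoolSemifield

/-! ### Ample groupoids -/

/-- The set of all arrows of a groupoid. -/
structure Arrows (C : Type u) [Groupoid.{v} C] where
  /-- the source object -/
  src : C
  /-- the range object -/
  tgt : C
  /-- the underlying morphism -/
  hom : src ⟶ tgt

namespace Arrows

variable {C : Type u} [Groupoid.{v} C]

/-- The unit at an object. -/
def unit (x : C) : Arrows C := ⟨x, x, 𝟙 x⟩

/-- The product `α β`, defined when the source of `α` is the range of `β`; it is the morphism
"first `β`, then `α`". -/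
def comp (α β : Arrows C) (h : α.src = β.tgt) : Arrows C :=
  ⟨β.src, α.tgt, β.hom ≫ eqToHom h.symm ≫ α.hom⟩

/-- The inverse arrow. -/
def inv (α : Arrows C) : Arrows C := ⟨α.tgt, α.src, Groupoid.inv α.hom⟩

variable (C) in
/-- The unit space, a subset (and, given a topology on the arrows, a subspace) of the arrows. -/
def unitSpace : Set (Arrows C) := Set.range unit

/-- The source map into the unit space. -/
def s (α : Arrows C) : unitSpace C := ⟨unit α.src, α.src, rfl⟩

/-- The range map into the unit space. -/
def r (α : Arrows C) : unitSpace C := ⟨unit α.tgt, α.tgt, rfl⟩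

theorem s_eq_s {α β : Arrows C} : s α = s β ↔ α.src = β.src :=
  ⟨fun h => congrArg (fun a : unitSpace C => a.1.src) h, fun h => by simp only [s, h]⟩

theorem r_eq_r {α β : Arrows C} : r α = r β ↔ α.tgt = β.tgt :=
  ⟨fun h => congrArg (fun a : unitSpace C => a.1.src) h, fun h => by simp only [r, h]⟩

theorem s_eq_r {α β : Arrows C} : s α = r β ↔ α.src = β.tgt :=
  ⟨fun h => congrArg (fun a : unitSpace C => a.1.src) h, fun h => by simp only [s, r, h]⟩

theorem comp_inv_comp (α β : Arrows C) (h : α.src = β.tgt) :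
    (α.comp β h).comp β.inv rfl = α := by
  obtain ⟨a, b, f⟩ := α
  obtain ⟨c, d, g⟩ := β
  obtain rfl : a = d := h
  simp [comp, inv]

theorem inv_comp_comp (α β : Arrows C) (h : α.src = β.tgt) :
    α.inv.comp (α.comp β h) rfl = β := by
  obtain ⟨a, b, f⟩ := α
  obtain ⟨c, d, g⟩ := β
  obtain rfl : a = d := h
  simp [comp, inv]

theorem comp_comp_inv (γ β : Arrows C) (h : γ.src = β.src) :
    (γ.comp β.inv h).comp β rfl = γ := by
  obtain ⟨a, b, f⟩ := γ
  obtain ⟨c, d, g⟩ := β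
  obtain rfl : a = c := h
  change (⟨a, b, g ≫ 𝟙 d ≫ Groupoid.inv g ≫ 𝟙 a ≫ f⟩ : Arrows C) = _
  simp

theorem comp_assoc (α β γ : Arrows C) (h : α.src = β.tgt) (h' : β.src = γ.tgt) :
    (α.comp β h).comp γ h' = α.comp (β.comp γ h') h := by
  simp [comp]

end Arrows

/-- A topological groupoid: composition, on the space of composable pairs, and inversion are
continuous. -/
class IsTopologicalGroupoid (C : Type u) [Groupoid.{v} C] [TopologicalSpace (Arrows C)] :
    Prop where
  continuous_comp : Continuous fun p : {p : Arrows C × Arrows C // p.1.src = p.2.tgt} =>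
    p.1.1.comp p.1.2 p.2
  continuous_inv : Continuous (Arrows.inv : Arrows C → Arrows C)

/-- An étale groupoid: the unit space is locally compact Hausdorff and source and range maps are
local homeomorphisms onto it. -/
class IsEtaleGroupoid (C : Type u) [Groupoid.{v} C] [TopologicalSpace (Arrows C)] : Prop
    extends IsTopologicalGroupoid C where
  locallyCompact : LocallyCompactSpace (Arrows.unitSpace C)
  hausdorff : T2Space (Arrows.unitSpace C)
  isLocalHomeomorph_s : IsLocalHomeomorph (Arrows.s : Arrows C → Arrows.unitSpace C)
  isLocalHomeomorph_r : IsLocalHomeomorph (Arrows.r : Arrows C → Arrows.unitSpace C)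

/-- An ample groupoid: an étale groupoid whose unit space is totally disconnected. -/
class IsAmpleGroupoid (C : Type u) [Groupoid.{v} C] [TopologicalSpace (Arrows C)] : Prop
    extends IsEtaleGroupoid C where
  totallyDisconnected : TotallyDisconnectedSpace (Arrows.unitSpace C)

section Dynamics

variable (C : Type u) [Groupoid.{v} C]

/-- The set of units whose isotropy group is trivial. -/
def trivialIsotropy : Set (Arrows.unitSpace C) :=
  {x | ∀ α : Arrows C, Arrows.s α = x → Arrows.r α = x → α = x}

variable {C} in
/-- A set of units is invariant if it contains the range of each arrow whose source it contains. -/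
def IsInvariantUnits (D : Set (Arrows.unitSpace C)) : Prop :=
  ∀ α : Arrows C, Arrows.s α ∈ D → Arrows.r α ∈ D

/-- Minimality: the only open invariant sets of units are the empty set and the unit space. -/
def IsMinimalGroupoid [TopologicalSpace (Arrows C)] : Prop :=
  ∀ D : Set (Arrows.unitSpace C), IsOpen D → IsInvariantUnits D → D = ∅ ∨ D = Set.univ

/-- The units with trivial isotropy are dense in the unit space. -/
def IsTopologicallyPrincipal [TopologicalSpace (Arrows C)] : Prop :=
  Dense (trivialIsotropy C)

end Dynamics

/-- Invariance of the set of units with trivial isotropy, in both directions. -/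
theorem trivialIsotropy_iff {C : Type u} [Groupoid.{v} C] (α : Arrows C) :
    Arrows.s α ∈ trivialIsotropy C ↔ Arrows.r α ∈ trivialIsotropy C := by
  have key : ∀ (x : C), Arrows.s (Arrows.unit x) ∈ trivialIsotropy C ↔
      ∀ f : x ⟶ x, f = 𝟙 x := by
    intro x
    constructor
    · intro h f
      have := h ⟨x, x, f⟩ rfl rfl
      simpa [Arrows.s, Arrows.unit] using this
    · rintro h ⟨a, b, f⟩ h1 h2
      obtain rfl : a = x := Arrows.s_eq_s.1 h1
      obtain rfl : a = b := Arrows.s_eq_r.1 h2.symm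
      rw [h f]; rfl
  obtain ⟨a, b, f⟩ := α
  refine (key a).trans (Iff.trans ?_ (key b).symm)
  constructor
  · intro h g
    have := h (f ≫ g ≫ Groupoid.inv f)
    calc g = Groupoid.inv f ≫ (f ≫ g ≫ Groupoid.inv f) ≫ f := by simp
      _ = 𝟙 b := by rw [this]; simp
  · intro h g
    have := h (Groupoid.inv f ≫ g ≫ f)
    calc g = f ≫ (Groupoid.inv f ≫ g ≫ f) ≫ Groupoid.inv f := by simp
      _ = 𝟙 a := by rw [this]; simp

/-! ### Compact open bisections -/

/-- A bisection: source and range map restrict to homeomorphisms onto their images. -/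
def IsBisection {C : Type u} [Groupoid.{v} C] [TopologicalSpace (Arrows C)]
    (U : Set (Arrows C)) : Prop :=
  Topology.IsEmbedding (U.domRestrict Arrows.s) ∧ Topology.IsEmbedding (U.domRestrict Arrows.r)

/-- A compact open bisection. -/
structure IsCompactOpenBisection {C : Type u} [Groupoid.{v} C] [TopologicalSpace (Arrows C)]
    (U : Set (Arrows C)) : Prop where
  isCompact : IsCompact U
  isOpen : IsOpen U
  isBisection : IsBisection U

/-- The product set `U V` of all defined products. -/
def Arrows.setMul {C : Type u} [Groupoid.{v} C] (U V : Set (Arrows C)) : Set (Arrows C) :=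
  {γ | ∃ α ∈ U, ∃ β ∈ V, ∃ h : α.src = β.tgt, α.comp β h = γ}

namespace IsCompactOpenBisection

variable {C : Type u} [Groupoid.{v} C] [TopologicalSpace (Arrows C)] {U V : Set (Arrows C)}

theorem eq_of_src (hU : IsCompactOpenBisection U) {α β : Arrows C} (hα : α ∈ U) (hβ : β ∈ U)
    (h : α.src = β.src) : α = β :=
  congrArg Subtype.val (hU.isBisection.1.injective (a₁ := ⟨α, hα⟩) (a₂ := ⟨β, hβ⟩)
    (Arrows.s_eq_s.2 h))

theorem eq_of_tgt (hU : IsCompactOpenBisection U) {α β : Arrows C} (hα : α ∈ U) (hβ : β ∈ U)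
    (h : α.tgt = β.tgt) : α = β :=
  congrArg Subtype.val (hU.isBisection.2.injective (a₁ := ⟨α, hα⟩) (a₂ := ⟨β, hβ⟩)
    (Arrows.r_eq_r.2 h))

/-- The product of two compact open bisections is a compact open bisection. -/
theorem setMul [IsEtaleGroupoid C] (hU : IsCompactOpenBisection U)
    (hV : IsCompactOpenBisection V) : IsCompactOpenBisection (Arrows.setMul U V) := by
  have hs : IsLocalHomeomorph (Arrows.s : Arrows C → _) := IsEtaleGroupoid.isLocalHomeomorph_s
  have hr : IsLocalHomeomorph (Arrows.r : Arrows C → _) := IsEtaleGroupoid.isLocalHomeomorph_r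
  have hcomp := IsTopologicalGroupoid.continuous_comp (C := C)
  have hinv := IsTopologicalGroupoid.continuous_inv (C := C)
  have : T2Space (Arrows.unitSpace C) := IsEtaleGroupoid.hausdorff
  have hopen : IsOpen (Arrows.setMul U V) := by
    let e := hV.isBisection.1.toHomeomorph
    let W : Set (Arrows C) := Arrows.s ⁻¹' (Set.range (V.domRestrict Arrows.s))
    have hW : IsOpen W := by
      refine IsOpen.preimage hs.continuous ?_
      rw [Set.range_domRestrict]
      exact hs.isOpenMap _ hV.isOpen
    let σ : W → V := fun γ => e.symm ⟨Arrows.s γ.1, γ.2⟩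
    have hσc : Continuous σ := e.symm.continuous.comp
      ((hs.continuous.comp continuous_subtype_val).subtype_mk _)
    have hσ : ∀ γ : W, γ.1.src = (σ γ).1.src := by
      intro γ
      have : e (σ γ) = ⟨Arrows.s γ.1, γ.2⟩ := e.apply_symm_apply _
      exact (Arrows.s_eq_s.1 (congrArg Subtype.val this)).symm
    let φ : W → Arrows C := fun γ => γ.1.comp (σ γ).1.inv (hσ γ)
    have hφ : Continuous φ := by
      have h1 : Continuous fun γ : W =>
          (⟨(γ.1, (σ γ).1.inv), hσ γ⟩ :
            {p : Arrows C × Arrows C // p.1.src = p.2.tgt}) :=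
        Continuous.subtype_mk (continuous_subtype_val.prodMk
          (hinv.comp (continuous_subtype_val.comp hσc))) _
      exact hcomp.comp h1
    have heq : Arrows.setMul U V = Subtype.val '' (φ ⁻¹' U) := by
      ext γ
      constructor
      · rintro ⟨α, hα, β, hβ, h, rfl⟩
        have hw : α.comp β h ∈ W := ⟨⟨β, hβ⟩, Arrows.s_eq_s.2 rfl⟩
        refine ⟨⟨_, hw⟩, ?_, rfl⟩
        have h2 : (σ ⟨_, hw⟩).1 = β :=
          hV.eq_of_src (σ ⟨_, hw⟩).2 hβ (hσ ⟨_, hw⟩).symm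
        have h3 : φ ⟨_, hw⟩ = α := by
          simp only [φ, h2]
          exact Arrows.comp_inv_comp α β h
        rw [Set.mem_preimage, h3]
        exact hα
      · rintro ⟨γ, hγ, rfl⟩
        exact ⟨φ γ, hγ, (σ γ).1, (σ γ).2, rfl, Arrows.comp_comp_inv _ _ (hσ γ)⟩
    rw [heq]
    exact hW.isOpenMap_subtype_val _ (hU.isOpen.preimage hφ)
  have hcompact : IsCompact (Arrows.setMul U V) := by
    have hcl : IsClosed {p : Arrows C × Arrows C | p.1.src = p.2.tgt} := by
      have : {p : Arrows C × Arrows C | p.1.src = p.2.tgt} =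
          {p | Arrows.s p.1 = Arrows.r p.2} := by
        ext p; exact Arrows.s_eq_r.symm
      rw [this]
      exact isClosed_eq (hs.continuous.comp continuous_fst) (hr.continuous.comp continuous_snd)
    have h1 : IsCompact ((Subtype.val :
        {p : Arrows C × Arrows C // p.1.src = p.2.tgt} → _) ⁻¹' (U ×ˢ V)) :=
      hcl.isClosedEmbedding_subtypeVal.isCompact_preimage (hU.isCompact.prod hV.isCompact)
    have heq : Arrows.setMul U V = (fun p : {p : Arrows C × Arrows C // p.1.src = p.2.tgt} =>
        p.1.1.comp p.1.2 p.2) '' (Subtype.val ⁻¹' (U ×ˢ V)) := by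
      ext γ
      constructor
      · rintro ⟨α, hα, β, hβ, h, rfl⟩
        exact ⟨⟨(α, β), h⟩, ⟨hα, hβ⟩, rfl⟩
      · rintro ⟨⟨⟨α, β⟩, h⟩, ⟨hα, hβ⟩, rfl⟩
        exact ⟨α, hα, β, hβ, h, rfl⟩
    rw [heq]
    exact h1.image hcomp
  refine ⟨hcompact, hopen, ?_, ?_⟩
  · refine (Topology.IsOpenEmbedding.of_continuous_injective_isOpenMap
      (hs.continuous.comp continuous_subtype_val) ?_
      (hs.isOpenMap.comp hopen.isOpenMap_subtype_val)).isEmbedding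
    rintro ⟨_, α, hα, β, hβ, h, rfl⟩ ⟨_, α', hα', β', hβ', h', rfl⟩ he
    have h1 : β = β' := hV.eq_of_src hβ hβ' (Arrows.s_eq_s.1 he)
    subst h1
    have h2 : α = α' := hU.eq_of_src hα hα' (h.trans h'.symm)
    subst h2
    rfl
  · refine (Topology.IsOpenEmbedding.of_continuous_injective_isOpenMap
      (hr.continuous.comp continuous_subtype_val) ?_
      (hr.isOpenMap.comp hopen.isOpenMap_subtype_val)).isEmbedding
    rintro ⟨_, α, hα, β, hβ, h, rfl⟩ ⟨_, α', hα', β', hβ', h', rfl⟩ he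
    have h1 : α = α' := hU.eq_of_tgt hα hα' (Arrows.r_eq_r.1 he)
    subst h1
    have h2 : β = β' := hV.eq_of_tgt hβ hβ' (h.symm.trans h')
    subst h2
    rfl

end IsCompactOpenBisection

/-! ### The Steinberg algebra -/

section Steinberg

variable {S : Type w} [CommSemiring S] {C : Type u} [Groupoid.{v} C]

/-- The pairs of composable arrows with product `γ`. -/
def Arrows.Factorization (γ : Arrows C) : Type (max u v) :=
  {p : Arrows C × Arrows C // ∃ h : p.1.src = p.2.tgt, p.1.comp p.2 h = γ}

/-- The convolution product; `finsum` is a genuine finite sum for elements of the Steinberg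
algebra, see `finite_support_conv`. -/
noncomputable def conv (f g : Arrows C → S) (γ : Arrows C) : S :=
  ∑ᶠ p : Arrows.Factorization γ, f p.1.1 * g p.1.2

theorem conv_zero_left (g : Arrows C → S) : conv 0 g = 0 := by
  funext γ
  simp [conv]

theorem conv_zero_right (f : Arrows C → S) : conv f 0 = 0 := by
  funext γ
  simp [conv]

variable (S C) [TopologicalSpace (Arrows C)]

/-- The module of functions spanned by the characteristic functions of compact open bisections. -/
def steinbergModule : Submodule S (Arrows C → S) :=
  Submodule.span S {f | ∃ U : Set (Arrows C), IsCompactOpenBisection U ∧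
    f = U.indicator fun _ => 1}

variable {S C}

theorem finite_support_conv {f : Arrows C → S} (hf : f ∈ steinbergModule S C)
    (g : Arrows C → S) (γ : Arrows C) :
    (Function.support fun p : Arrows.Factorization γ => f p.1.1 * g p.1.2).Finite := by
  have hfin : ∀ x : C, {α : Arrows C | α.tgt = x ∧ f α ≠ 0}.Finite := by
    intro x
    induction hf using Submodule.span_induction with
    | mem f hf =>
      obtain ⟨U, hU, rfl⟩ := hf
      refine Set.Subsingleton.finite ?_
      rintro α ⟨h1, h2⟩ β ⟨h3, h4⟩
      exact hU.eq_of_tgt (Set.mem_of_indicator_ne_zero h2) (Set.mem_of_indicator_ne_zero h4)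
        (h1.trans h3.symm)
    | zero => simp
    | add f f' _ _ h h' =>
      refine (h.union h').subset ?_
      rintro α ⟨h1, h2⟩
      by_cases h0 : f α = 0
      · refine Or.inr ⟨h1, fun h3 => h2 ?_⟩
        simp [h0, h3]
      · exact Or.inl ⟨h1, h0⟩
    | smul a f _ h =>
      refine h.subset ?_
      rintro α ⟨h1, h2⟩
      refine ⟨h1, fun h3 => h2 ?_⟩
      simp [h3]
  refine Set.Finite.of_finite_image (f := fun p : Arrows.Factorization γ => p.1.1)
    ((hfin γ.tgt).subset ?_) ?_
  · rintro _ ⟨⟨⟨α, β⟩, h, rfl⟩, h2, rfl⟩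
    exact ⟨rfl, left_ne_zero_of_mul h2⟩
  · rintro ⟨⟨α, β⟩, h, hc⟩ _ ⟨⟨α', β'⟩, h', hc'⟩ _ (he : α = α')
    subst he
    have : β = β' := by
      rw [← Arrows.inv_comp_comp α β h, ← Arrows.inv_comp_comp α β' h']
      simp only at hc hc'
      simp only [hc, hc']
    subst this
    rfl

theorem conv_add_left {f f' : Arrows C → S} (hf : f ∈ steinbergModule S C)
    (hf' : f' ∈ steinbergModule S C) (g : Arrows C → S) :
    conv (f + f') g = conv f g + conv f' g := by
  funext γ
  simp only [conv, Pi.add_apply, add_mul]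
  exact finsum_add_distrib (finite_support_conv hf g γ) (finite_support_conv hf' g γ)

theorem conv_add_right {f : Arrows C → S} (hf : f ∈ steinbergModule S C)
    (g g' : Arrows C → S) : conv f (g + g') = conv f g + conv f g' := by
  funext γ
  simp only [conv, Pi.add_apply, mul_add]
  exact finsum_add_distrib (finite_support_conv hf g γ) (finite_support_conv hf g' γ)

theorem conv_smul_left (a : S) {f : Arrows C → S} (hf : f ∈ steinbergModule S C)
    (g : Arrows C → S) : conv (a • f) g = a • conv f g := by
  funext γ
  simp only [conv, Pi.smul_apply, smul_eq_mul, mul_assoc]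
  exact (mul_finsum' _ _ (finite_support_conv hf g γ)).symm

theorem conv_smul_right (a : S) {f : Arrows C → S} (hf : f ∈ steinbergModule S C)
    (g : Arrows C → S) : conv f (a • g) = a • conv f g := by
  funext γ
  simp only [conv, Pi.smul_apply, smul_eq_mul, mul_left_comm _ a]
  exact (mul_finsum' _ _ (finite_support_conv hf g γ)).symm

/-- `1_U * 1_V = 1_{UV}`. -/
theorem conv_indicator {U V : Set (Arrows C)} (hU : IsCompactOpenBisection U) :
    conv (U.indicator fun _ => (1 : S)) (V.indicator fun _ => (1 : S)) =
      (Arrows.setMul U V).indicator fun _ => (1 : S) := by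
  classical
  funext γ
  by_cases hγ : γ ∈ Arrows.setMul U V
  · obtain ⟨α, hα, β, hβ, h, rfl⟩ := id hγ
    rw [Set.indicator_of_mem hγ, conv, finsum_eq_single _ ⟨(α, β), h, rfl⟩]
    · simp [hα, hβ]
    · rintro ⟨⟨α', β'⟩, h', hc⟩ hne
      by_contra h0
      have hα' : α' ∈ U := Set.mem_of_indicator_ne_zero (left_ne_zero_of_mul h0)
      have h1 : α' = α := hU.eq_of_tgt hα' hα (show (α'.comp β' h').tgt = (α.comp β h).tgt from congrArg Arrows.tgt hc)
      subst h1
      have h2 : β' = β := by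
        rw [← Arrows.inv_comp_comp α' β' h', ← Arrows.inv_comp_comp α' β h]
        simp only at hc
        simp only [hc]
      subst h2
      exact hne rfl
  · rw [Set.indicator_of_notMem hγ, conv]
    refine finsum_eq_zero_of_forall_eq_zero ?_
    rintro ⟨⟨α, β⟩, h, hc⟩
    by_contra h0
    exact hγ ⟨α, Set.mem_of_indicator_ne_zero (left_ne_zero_of_mul h0), β,
      Set.mem_of_indicator_ne_zero (right_ne_zero_of_mul h0), h, hc⟩

theorem conv_mem [IsEtaleGroupoid C] {f g : Arrows C → S} (hf : f ∈ steinbergModule S C)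
    (hg : g ∈ steinbergModule S C) : conv f g ∈ steinbergModule S C := by
  induction hf using Submodule.span_induction with
  | mem f hf =>
    have hf' : f ∈ steinbergModule S C := Submodule.subset_span hf
    induction hg using Submodule.span_induction with
    | mem g hg =>
      obtain ⟨U, hU, rfl⟩ := hf
      obtain ⟨V, hV, rfl⟩ := hg
      exact Submodule.subset_span ⟨_, hU.setMul hV, conv_indicator hU⟩
    | zero => rw [conv_zero_right]; exact Submodule.zero_mem _
    | add g g' _ _ h h' => rw [conv_add_right hf']; exact Submodule.add_mem _ h h'
    | smul a g _ h => rw [conv_smul_right a hf']; exact Submodule.smul_mem _ a h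
  | zero => rw [conv_zero_left]; exact Submodule.zero_mem _
  | add f f' hf hf' h h' => rw [conv_add_left hf hf']; exact Submodule.add_mem _ h h'
  | smul a f hf h => rw [conv_smul_left a hf]; exact Submodule.smul_mem _ a h

theorem conv_assoc [IsEtaleGroupoid C] {f g k : Arrows C → S} (hf : f ∈ steinbergModule S C)
    (hg : g ∈ steinbergModule S C) (hk : k ∈ steinbergModule S C) :
    conv (conv f g) k = conv f (conv g k) := by
  induction hf using Submodule.span_induction with
  | mem f hf =>
    have hf' : f ∈ steinbergModule S C := Submodule.subset_span hf
    induction hg using Submodule.span_induction with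
    | mem g hg =>
      have hg' : g ∈ steinbergModule S C := Submodule.subset_span hg
      have hfg := conv_mem hf' hg'
      induction hk using Submodule.span_induction with
      | mem k hk =>
        obtain ⟨U, hU, rfl⟩ := hf
        obtain ⟨V, hV, rfl⟩ := hg
        obtain ⟨W, hW, rfl⟩ := hk
        rw [conv_indicator hU, conv_indicator (hU.setMul hV), conv_indicator hV,
          conv_indicator hU]
        congr 1
        ext γ
        constructor
        · rintro ⟨_, ⟨α, hα, β, hβ, h, rfl⟩, δ, hδ, h', rfl⟩
          exact ⟨α, hα, _, ⟨β, hβ, δ, hδ, h', rfl⟩, h, (Arrows.comp_assoc α β δ h h').symm⟩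
        · rintro ⟨α, hα, _, ⟨β, hβ, δ, hδ, h', rfl⟩, h, rfl⟩
          exact ⟨_, ⟨α, hα, β, hβ, h, rfl⟩, δ, hδ, h', Arrows.comp_assoc α β δ h h'⟩
      | zero => simp only [conv_zero_right]
      | add k k' _ _ h h' =>
        rw [conv_add_right hfg, conv_add_right hg', conv_add_right hf', h, h']
      | smul a k _ h =>
        rw [conv_smul_right a hfg, conv_smul_right a hg', conv_smul_right a hf', h]
    | zero => simp only [conv_zero_right, conv_zero_left]
    | add g g' hg hg' h h' =>
      rw [conv_add_right hf', conv_add_left (conv_mem hf' hg) (conv_mem hf' hg'),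
        conv_add_left hg hg', conv_add_right hf', h, h']
    | smul a g hg h =>
      rw [conv_smul_right a hf', conv_smul_left a (conv_mem hf' hg), conv_smul_left a hg,
        conv_smul_right a hf', h]
  | zero => simp only [conv_zero_left]
  | add f f' hf hf' h h' =>
    rw [conv_add_left hf hf', conv_add_left (conv_mem hf hg) (conv_mem hf' hg),
      conv_add_left hf hf', h, h']
  | smul a f hf h =>
    rw [conv_smul_left a hf, conv_smul_left a (conv_mem hf hg), conv_smul_left a hf, h]

variable (S C)

/-- The Steinberg algebra `A_S(G)` of the groupoid `G` of arrows of `C`, with pointwise addition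
and convolution as multiplication. -/
def SteinbergAlgebra : Type (max u v w) := steinbergModule S C

namespace SteinbergAlgebra

noncomputable instance : AddCommMonoid (SteinbergAlgebra S C) :=
  inferInstanceAs (AddCommMonoid (steinbergModule S C))

noncomputable instance : Module S (SteinbergAlgebra S C) :=
  inferInstanceAs (Module S (steinbergModule S C))

noncomputable instance [IsAmpleGroupoid C] : NonUnitalSemiring (SteinbergAlgebra S C) where
  mul f g := ⟨conv f.1 g.1, conv_mem f.2 g.2⟩
  left_distrib f g k := Subtype.ext (conv_add_right f.2 g.1 k.1)
  right_distrib f g k := Subtype.ext (conv_add_left f.2 g.2 k.1)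
  zero_mul f := Subtype.ext (conv_zero_left f.1)
  mul_zero f := Subtype.ext (conv_zero_right f.1)
  mul_assoc f g k := Subtype.ext (conv_assoc f.2 g.2 k.2)

instance [IsAmpleGroupoid C] : IsScalarTower S (SteinbergAlgebra S C) (SteinbergAlgebra S C) :=
  ⟨fun a f g => Subtype.ext (conv_smul_left a f.2 g.1)⟩

instance [IsAmpleGroupoid C] : SMulCommClass S (SteinbergAlgebra S C) (SteinbergAlgebra S C) :=
  ⟨fun a f g => Subtype.ext (conv_smul_right a f.2 g.1).symm⟩

end SteinbergAlgebra

/-- The congruence that identifies `f` and `g` if `f α = g α` for all arrows `α` whose source and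
range have trivial isotropy. -/
noncomputable def steinbergCon [IsAmpleGroupoid C] : RingCon (SteinbergAlgebra S C) where
  r f g := ∀ α : Arrows C, Arrows.s α ∈ trivialIsotropy C → Arrows.r α ∈ trivialIsotropy C →
    f.1 α = g.1 α
  iseqv := ⟨fun _ _ _ _ => rfl, fun h α h1 h2 => (h α h1 h2).symm,
    fun h h' α h1 h2 => (h α h1 h2).trans (h' α h1 h2)⟩
  add' := fun h h' α h1 h2 => congrArg₂ (· + ·) (h α h1 h2) (h' α h1 h2)
  mul' := by
    intro f f' g g' h h' γ h1 h2
    refine finsum_congr ?_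
    rintro ⟨⟨α, β⟩, hc, rfl⟩
    have hβ : Arrows.s β ∈ trivialIsotropy C := h1
    have hα : Arrows.r α ∈ trivialIsotropy C := h2
    exact congrArg₂ (· * ·) (h α ((trivialIsotropy_iff α).2 hα) hα)
      (h' β hβ ((trivialIsotropy_iff β).1 hβ))

end Steinberg

/-! ### Congruence-simplicity -/

/-- A hemiring is congruence-simple if its only congruences are the diagonal one `⊥` and the full
one `⊤`. -/
def IsCongruenceSimple (R : Type*) [NonUnitalSemiring R] : Prop :=
  ∀ c : RingCon R, c = ⊥ ∨ c = ⊤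

/-! ### Compact open sets in étale and ample groupoids -/

section Topology

variable {C : Type u} [Groupoid.{v} C]

/-! Congruences on the quotient correspond to the congruences `d` on the algebra that contain `≡`
(`isCongruenceSimple_quotient_iff`).

Sufficiency. If such a `d` is larger than `≡`, it relates some `f` and `g` that differ at an arrow
`α` between units with trivial isotropy. Multiplying by a bisection through `α⁻¹` moves the
difference to the unit `x = s(α)`. A bisection that misses `x` but has an arrow with source `x`
moves `x`, since the isotropy there is trivial, and hence moves a small neighbourhood off itself. As
`f` is a finite combination of bisections, `1_V * f * 1_V = f(x) 1_V` for every small enough compact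
open `V` around `x` (`exists_open_corner_eq_smul`). So `d` relates `a 1_V` and `b 1_V` for some `a ≠
b`, and therefore `1_V` and `0`: over a field subtract and divide, over the Boolean semifield `a`
and `b` are `0` and `1` (`RingCon.rel_zero_of_smul_rel_smul`). Minimality and compactness spread
this to `1_W` for arbitrarily large compact open `W`, and every `f` is a sum of terms absorbing such
a `1_W`, so `d` is full (`eq_top_of_char_rel_zero`).

Necessity. A homomorphism `φ` from `S` to a nontrivial semiring gives a congruence containing `≡`
that compares `φ ∘ f` with `φ ∘ g`. It separates `1_V` from `0`, so simplicity makes it equal to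
`≡`, which forces `φ` to be injective (`injective_of_isCongruenceSimple`). If `1` has an additive
inverse, `S` is a field. Otherwise sums of nonzero elements are nonzero, and sending every nonzero
element to `1` is a homomorphism onto the Boolean semifield, hence an isomorphism. -/

theorem Arrows.s_coe (y : Arrows.unitSpace C) : Arrows.s (y : Arrows C) = y := by
  obtain ⟨_, x, rfl⟩ := y
  rfl

theorem Arrows.r_coe (y : Arrows.unitSpace C) : Arrows.r (y : Arrows C) = y := by
  obtain ⟨_, x, rfl⟩ := y
  rfl

theorem Arrows.comp_unit (α : Arrows C) : α.comp (Arrows.unit α.src) rfl = α := by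
  simp [Arrows.comp, Arrows.unit]

theorem Arrows.unit_comp (α : Arrows C) : (Arrows.unit α.tgt).comp α rfl = α := by
  simp [Arrows.comp, Arrows.unit]

theorem Arrows.inv_comp (α : Arrows C) : α.inv.comp α rfl = Arrows.unit α.src := by
  simp [Arrows.comp, Arrows.unit, Arrows.inv]

theorem Arrows.comp_inv (α : Arrows C) : α.comp α.inv rfl = Arrows.unit α.tgt := by
  simp [Arrows.comp, Arrows.unit, Arrows.inv]

theorem Arrows.comp_left_cancel {α β β' : Arrows C} (h : α.src = β.tgt) (h' : α.src = β'.tgt)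
    (hc : α.comp β h = α.comp β' h') : β = β' := by
  rw [← Arrows.inv_comp_comp α β h, ← Arrows.inv_comp_comp α β' h']
  simp only [hc]

/-- An arrow composed with a unit on the right is unchanged. -/
theorem Arrows.comp_coe (α : Arrows C) (y : Arrows.unitSpace C) (h : α.src = (y : Arrows C).tgt) :
    α.comp y h = α := by
  obtain ⟨_, x, rfl⟩ := y
  obtain rfl : α.src = x := h
  exact α.comp_unit

/-- An arrow composed with a unit on the left is unchanged. -/
theorem Arrows.coe_comp (α : Arrows C) (y : Arrows.unitSpace C) (h : (y : Arrows C).src = α.tgt) :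
    Arrows.comp y α h = α := by
  obtain ⟨_, x, rfl⟩ := y
  obtain rfl : x = α.tgt := h
  exact α.unit_comp

/-- The product of a set of arrows with a set of units on the right. -/
theorem Arrows.mem_setMul_coe {U : Set (Arrows C)} {W : Set (Arrows.unitSpace C)} {γ : Arrows C} :
    γ ∈ Arrows.setMul U (Subtype.val '' W) ↔ γ ∈ U ∧ Arrows.s γ ∈ W := by
  constructor
  · rintro ⟨α, hα, _, ⟨y, hy, rfl⟩, h, rfl⟩
    rw [Arrows.comp_coe]
    refine ⟨hα, ?_⟩
    rwa [Arrows.s_eq_r.2 h, Arrows.r_coe]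
  · rintro ⟨h1, h2⟩
    exact ⟨γ, h1, _, ⟨_, h2, rfl⟩, rfl, Arrows.comp_coe _ _ _⟩

/-- The product of a set of units with a set of arrows. -/
theorem Arrows.mem_coe_setMul {U : Set (Arrows C)} {W : Set (Arrows.unitSpace C)} {γ : Arrows C} :
    γ ∈ Arrows.setMul (Subtype.val '' W) U ↔ γ ∈ U ∧ Arrows.r γ ∈ W := by
  constructor
  · rintro ⟨_, ⟨y, hy, rfl⟩, β, hβ, h, rfl⟩
    rw [Arrows.coe_comp]
    refine ⟨hβ, ?_⟩
    rwa [← Arrows.s_eq_r.2 h, Arrows.s_coe]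
  · rintro ⟨h1, h2⟩
    exact ⟨_, ⟨_, h2, rfl⟩, γ, h1, rfl, Arrows.coe_comp _ _ _⟩

/-! ### Compact open bisections and corners at units with trivial isotropy -/

variable [TopologicalSpace (Arrows C)]

/-- In an étale groupoid the unit space is open. -/
theorem isOpen_unitSpace [IsEtaleGroupoid C] : IsOpen (Arrows.unitSpace C) := by
  have hs : IsLocalHomeomorph (Arrows.s : Arrows C → _) := IsEtaleGroupoid.isLocalHomeomorph_s
  rw [isOpen_iff_mem_nhds]
  intro x hx
  obtain ⟨e, hxe, he⟩ := hs x
  -- On this set both `γ` and `s γ` lie in the chart, and they have the same source, so they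
  -- coincide.
  have h1 : IsOpen (e.source ∩ Arrows.s ⁻¹' (Subtype.val ⁻¹' e.source)) :=
    e.open_source.inter ((e.open_source.preimage continuous_subtype_val).preimage hs.continuous)
  have hsx : Arrows.s x = ⟨x, hx⟩ := Arrows.s_coe ⟨x, hx⟩
  refine Filter.mem_of_superset (h1.mem_nhds ⟨hxe, ?_⟩) ?_
  · simpa [hsx] using hxe
  · rintro γ ⟨hγ, hγ'⟩
    have : γ = Arrows.s γ := by
      refine e.injOn hγ hγ' ?_
      rw [← he, Arrows.s_coe]
    rw [this]
    exact (Arrows.s γ).2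

/-- A compact open subset of the arrows on which source and range are injective is a compact open
bisection. -/
theorem IsCompactOpenBisection.of_injOn [IsEtaleGroupoid C] {U : Set (Arrows C)}
    (hc : IsCompact U) (ho : IsOpen U) (hs : Set.InjOn Arrows.s U) (hr : Set.InjOn Arrows.r U) :
    IsCompactOpenBisection U := by
  have hs' : IsLocalHomeomorph (Arrows.s : Arrows C → _) := IsEtaleGroupoid.isLocalHomeomorph_s
  have hr' : IsLocalHomeomorph (Arrows.r : Arrows C → _) := IsEtaleGroupoid.isLocalHomeomorph_r
  refine ⟨hc, ho, ?_, ?_⟩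
  · exact (Topology.IsOpenEmbedding.of_continuous_injective_isOpenMap
      (hs'.continuous.comp continuous_subtype_val) (Set.injOn_iff_injective.1 hs)
      (hs'.isOpenMap.comp ho.isOpenMap_subtype_val)).isEmbedding
  · exact (Topology.IsOpenEmbedding.of_continuous_injective_isOpenMap
      (hr'.continuous.comp continuous_subtype_val) (Set.injOn_iff_injective.1 hr)
      (hr'.isOpenMap.comp ho.isOpenMap_subtype_val)).isEmbedding

/-- A compact open set of units is a compact open bisection. -/
theorem isCompactOpenBisection_coe [IsEtaleGroupoid C] {W : Set (Arrows.unitSpace C)}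
    (hc : IsCompact W) (ho : IsOpen W) : IsCompactOpenBisection (Subtype.val '' W) := by
  refine .of_injOn (hc.image continuous_subtype_val)
    (isOpen_unitSpace.isOpenMap_subtype_val _ ho) ?_ ?_
  · rintro _ ⟨y, hy, rfl⟩ _ ⟨z, hz, rfl⟩ h
    rw [Arrows.s_coe, Arrows.s_coe] at h
    rw [h]
  · rintro _ ⟨y, hy, rfl⟩ _ ⟨z, hz, rfl⟩ h
    rw [Arrows.r_coe, Arrows.r_coe] at h
    rw [h]

/-- In a locally compact, Hausdorff, totally disconnected space each point has arbitrarily small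
compact open neighbourhoods. -/
theorem exists_isCompact_isOpen_subset {X : Type*} [TopologicalSpace X] [LocallyCompactSpace X]
    [T2Space X] [TotallyDisconnectedSpace X] {x : X} {O : Set X} (hO : IsOpen O) (hx : x ∈ O) :
    ∃ W : Set X, IsCompact W ∧ IsOpen W ∧ x ∈ W ∧ W ⊆ O := by
  obtain ⟨K, hK, hKO, hKc⟩ := local_compact_nhds (hO.mem_nhds hx)
  obtain ⟨W, hW, hxW, hWK⟩ :=
    (loc_compact_Haus_tot_disc_of_zero_dim (H := X)).exists_subset_of_mem_open
      (mem_interior_iff_mem_nhds.2 hK) isOpen_interior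
  have hWK' : W ⊆ K := hWK.trans interior_subset
  exact ⟨W, hKc.of_isClosed_subset hW.1 hWK', hW.2, hxW, hWK'.trans hKO⟩

theorem exists_isCompact_isOpen_units [IsAmpleGroupoid C] {x : Arrows.unitSpace C}
    {O : Set (Arrows.unitSpace C)} (hO : IsOpen O) (hx : x ∈ O) :
    ∃ W : Set (Arrows.unitSpace C), IsCompact W ∧ IsOpen W ∧ x ∈ W ∧ W ⊆ O := by
  have : LocallyCompactSpace (Arrows.unitSpace C) := IsEtaleGroupoid.locallyCompact
  have : T2Space (Arrows.unitSpace C) := IsEtaleGroupoid.hausdorff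
  have : TotallyDisconnectedSpace (Arrows.unitSpace C) := IsAmpleGroupoid.totallyDisconnected
  exact exists_isCompact_isOpen_subset hO hx

/-- Each arrow of an ample groupoid lies in a compact open bisection. -/
theorem exists_isCompactOpenBisection_mem [IsAmpleGroupoid C] (γ : Arrows C) :
    ∃ U : Set (Arrows C), IsCompactOpenBisection U ∧ γ ∈ U := by
  have hs : IsLocalHomeomorph (Arrows.s : Arrows C → _) := IsEtaleGroupoid.isLocalHomeomorph_s
  have hr : IsLocalHomeomorph (Arrows.r : Arrows C → _) := IsEtaleGroupoid.isLocalHomeomorph_r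
  obtain ⟨e, hγe, he⟩ := hs γ
  obtain ⟨e', hγe', he'⟩ := hr γ
  -- The local section of `s` over such a `W` lands in both charts, so `r` is injective on its image
  -- too.
  obtain ⟨W, hWc, hWo, hγW, hWO⟩ := exists_isCompact_isOpen_units
    (hs.isOpenMap _ (e.open_source.inter e'.open_source)) ⟨γ, ⟨hγe, hγe'⟩, rfl⟩
  have hsub : W ⊆ e.target := by
    intro y hy
    obtain ⟨β, hβ, rfl⟩ := hWO hy
    rw [he]
    exact e.map_source hβ.1
  have hW : ∀ y ∈ W, e.symm y ∈ e'.source := by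
    intro y hy
    obtain ⟨β, hβ, rfl⟩ := hWO hy
    rw [he, e.left_inv hβ.1]
    exact hβ.2
  have hinj : Set.InjOn Arrows.s (e.symm '' W) := by
    rw [he]
    exact e.injOn.mono (by
      rintro _ ⟨y, hy, rfl⟩
      exact e.map_target (hsub hy))
  refine ⟨e.symm '' W, .of_injOn (hWc.image_of_continuousOn (e.continuousOn_symm.mono hsub))
    (e.symm.isOpen_image_of_subset_source hWo hsub) hinj ?_, Arrows.s γ, hγW, ?_⟩
  · rw [he']
    refine e'.injOn.mono ?_
    rintro _ ⟨y, hy, rfl⟩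
    exact hW y hy
  · rw [he, e.left_inv hγe]

/-- If `x` has trivial isotropy and `U` is a compact open bisection, then for some neighbourhood
`O` of `x` the corner `O U O` consists of units, and is empty unless `U` contains `x`. -/
theorem exists_open_corner [IsEtaleGroupoid C] {U : Set (Arrows C)}
    (hU : IsCompactOpenBisection U) {x : Arrows.unitSpace C} (hx : x ∈ trivialIsotropy C) :
    ∃ O : Set (Arrows.unitSpace C), IsOpen O ∧ x ∈ O ∧ ∀ α ∈ U, Arrows.s α ∈ O → Arrows.r α ∈ O →
      (x : Arrows C) ∈ U ∧ α = Arrows.s α := by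
  have hs : IsLocalHomeomorph (Arrows.s : Arrows C → _) := IsEtaleGroupoid.isLocalHomeomorph_s
  have hr : IsLocalHomeomorph (Arrows.r : Arrows C → _) := IsEtaleGroupoid.isLocalHomeomorph_r
  have : T2Space (Arrows.unitSpace C) := IsEtaleGroupoid.hausdorff
  by_cases hxU : (x : Arrows C) ∈ U
  · refine ⟨Subtype.val ⁻¹' U, hU.isOpen.preimage continuous_subtype_val, hxU, ?_⟩
    intro α hα hsα _
    exact ⟨hxU, hU.eq_of_src hα hsα (Arrows.s_eq_s.1 (Arrows.s_coe _).symm)⟩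
  · by_cases hxs : x ∈ Arrows.s '' U
    · obtain ⟨γ, hγ, hγx⟩ := hxs
      -- Trivial isotropy enters here: if `γ` were a loop at `x`, it would be `x` itself, which is
      -- not in `U`.
      have hne : Arrows.s γ ≠ Arrows.r γ := fun h =>
        hxU (hx γ hγx (h ▸ hγx) ▸ hγ)
      -- Near `x` every arrow of `U` has its source in `O₁` and its range in the disjoint set `O₂`,
      -- so the corner is empty.
      obtain ⟨O₁, O₂, h1, h2, hγ1, hγ2, hd⟩ := t2_separation hne
      refine ⟨O₁ ∩ Arrows.s '' (U ∩ Arrows.r ⁻¹' O₂), h1.inter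
        (hs.isOpenMap _ (hU.isOpen.inter (h2.preimage hr.continuous))),
        hγx ▸ ⟨hγ1, γ, ⟨hγ, hγ2⟩, rfl⟩, ?_⟩
      rintro α hα ⟨_, β, ⟨hβ, hβ2⟩, hβα⟩ ⟨hα1, _⟩
      obtain rfl : β = α := hU.eq_of_src hβ hα (Arrows.s_eq_s.1 hβα)
      exact (Set.disjoint_left.1 hd hα1 hβ2).elim
    · exact ⟨(Arrows.s '' U)ᶜ, (hU.isCompact.image hs.continuous).isClosed.isOpen_compl, hxs,
        fun α hα h => (h ⟨α, hα, rfl⟩).elim⟩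

end Topology

/-! ### Characteristic functions in the Steinberg algebra -/

namespace SteinbergAlgebra

variable {S : Type w} [CommSemiring S] {C : Type u} [Groupoid.{v} C] [TopologicalSpace (Arrows C)]

variable (S) in
/-- The characteristic function of a compact open bisection. -/
noncomputable def char {U : Set (Arrows C)} (hU : IsCompactOpenBisection U) : SteinbergAlgebra S C :=
  ⟨U.indicator fun _ => 1, Submodule.subset_span ⟨U, hU, rfl⟩⟩

@[elab_as_elim]
theorem induction_on {p : SteinbergAlgebra S C → Prop} (f : SteinbergAlgebra S C)
    (char : ∀ (U : Set (Arrows C)) (hU : IsCompactOpenBisection U), p (char S hU)) (zero : p 0)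
    (add : ∀ f g, p f → p g → p (f + g)) (smul : ∀ (a : S) f, p f → p (a • f)) : p f := by
  obtain ⟨f, hf⟩ := f
  induction hf using Submodule.span_induction with
  | mem f hf =>
    obtain ⟨U, hU, rfl⟩ := hf
    exact char U hU
  | zero => exact zero
  | add f g _ _ h h' => exact add _ _ h h'
  | smul a f _ h => exact smul a _ h

theorem char_val {U : Set (Arrows C)} (hU : IsCompactOpenBisection U) :
    (char S hU).1 = U.indicator fun _ => 1 := rfl

theorem char_congr {U V : Set (Arrows C)} (hU : IsCompactOpenBisection U)
    (hV : IsCompactOpenBisection V) (h : U = V) : char S hU = char S hV := by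
  subst h
  rfl

theorem char_empty {U : Set (Arrows C)} (hU : IsCompactOpenBisection U) (h : U = ∅) :
    char S hU = 0 := by
  subst h
  exact Subtype.ext (Set.indicator_empty _)

variable [IsAmpleGroupoid C]

theorem char_mul_char {U V : Set (Arrows C)} (hU : IsCompactOpenBisection U)
    (hV : IsCompactOpenBisection V) : char S hU * char S hV = char S (hU.setMul hV) :=
  Subtype.ext (conv_indicator hU)

/-- Multiplying by the characteristic function of units that contain all sources. -/
theorem char_mul_char_coe {U : Set (Arrows C)} (hU : IsCompactOpenBisection U)
    {W : Set (Arrows.unitSpace C)} (hW : IsCompactOpenBisection (Subtype.val '' W))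
    (h : ∀ α ∈ U, Arrows.s α ∈ W) : char S hU * char S hW = char S hU := by
  rw [char_mul_char]
  refine char_congr _ _ ?_
  ext γ
  rw [Arrows.mem_setMul_coe]
  exact ⟨And.left, fun hγ => ⟨hγ, h γ hγ⟩⟩

/-- If a bisection `U` contains a set `V` of units, then `1_V * 1_U = 1_V`. -/
theorem char_coe_mul_char {U : Set (Arrows C)} (hU : IsCompactOpenBisection U)
    {V : Set (Arrows.unitSpace C)} (hV : IsCompactOpenBisection (Subtype.val '' V))
    (h : Subtype.val '' V ⊆ U) : char S hV * char S hU = char S hV := by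
  rw [char_mul_char]
  refine char_congr _ _ ?_
  ext γ
  rw [Arrows.mem_coe_setMul]
  constructor
  · rintro ⟨hγ, hγV⟩
    have : γ = Arrows.r γ := hU.eq_of_tgt hγ (h ⟨_, hγV, rfl⟩) (Arrows.r_eq_r.1 (Arrows.r_coe _).symm)
    rw [this]
    exact ⟨_, hγV, rfl⟩
  · rintro ⟨y, hy, rfl⟩
    exact ⟨h ⟨y, hy, rfl⟩, by rwa [Arrows.r_coe]⟩

/-- Left multiplication by a bisection that contains `α⁻¹` moves the value at `α` to the source. -/
theorem char_mul_apply_s {B : Set (Arrows C)} (hB : IsCompactOpenBisection B) {α : Arrows C}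
    (hα : α.inv ∈ B) (f : SteinbergAlgebra S C) :
    (char S hB * f).1 (Arrows.s α) = f.1 α := by
  change conv (char S hB).1 f.1 _ = _
  -- The range of the first factor is prescribed, so `α⁻¹` is the only possible first factor in the
  -- bisection `B`, and it determines the second.
  rw [conv, finsum_eq_single _ ⟨(α.inv, α), rfl, α.inv_comp⟩]
  · simp [char_val, hα]
  · rintro ⟨⟨β, γ⟩, h, hc⟩ hne
    by_contra h0
    have hβ : β ∈ B := by
      by_contra hβ
      exact h0 (by simp [char_val, hβ])
    have h1 : β = α.inv :=
      hB.eq_of_tgt hβ hα (congrArg Arrows.tgt hc : (β.comp γ h).tgt = (Arrows.unit α.src).tgt)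
    subst h1
    have h2 : γ = α := Arrows.comp_left_cancel h rfl (hc.trans α.inv_comp.symm)
    subst h2
    exact hne rfl

/-- Near a unit `x` with trivial isotropy, corners of `f` are multiples of units. -/
theorem exists_open_corner_eq_smul (f : SteinbergAlgebra S C) {x : Arrows.unitSpace C}
    (hx : x ∈ trivialIsotropy C) :
    ∃ O : Set (Arrows.unitSpace C), IsOpen O ∧ x ∈ O ∧ ∀ (V : Set (Arrows.unitSpace C))
      (hV : IsCompactOpenBisection (Subtype.val '' V)), x ∈ V → V ⊆ O →
      char S hV * (f * char S hV) = f.1 x • char S hV := by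
  induction f using induction_on with
  | char U hU =>
    obtain ⟨O, hO, hxO, h⟩ := exists_open_corner hU hx
    -- The set `O` only yields `V U V ⊆ V`; the reverse inclusion needs `V ⊆ U`, which `O'`
    -- provides.
    have hO' : ∃ O' : Set (Arrows.unitSpace C), IsOpen O' ∧ x ∈ O' ∧
        ((x : Arrows C) ∈ U → Subtype.val '' O' ⊆ U) := by
      by_cases hxU : (x : Arrows C) ∈ U
      · exact ⟨Subtype.val ⁻¹' U, hU.isOpen.preimage continuous_subtype_val, hxU,
          fun _ => Set.image_preimage_subset _ _⟩
      · exact ⟨Set.univ, isOpen_univ, trivial, fun h => (hxU h).elim⟩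
    obtain ⟨O', hO'o, hxO', hO'U⟩ := hO'
    refine ⟨O ∩ O', hO.inter hO'o, ⟨hxO, hxO'⟩, fun V hV hxV hVO => ?_⟩
    rw [char_mul_char, char_mul_char]
    have key : ∀ γ, γ ∈ Arrows.setMul (Subtype.val '' V) (Arrows.setMul U (Subtype.val '' V)) →
        (x : Arrows C) ∈ U ∧ γ ∈ Subtype.val '' V := by
      intro γ hγ
      rw [Arrows.mem_coe_setMul, Arrows.mem_setMul_coe] at hγ
      obtain ⟨h1, h2⟩ := h γ hγ.1.1 (hVO hγ.1.2).1 (hVO hγ.2).1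
      exact ⟨h1, h2 ▸ ⟨_, hγ.1.2, rfl⟩⟩
    by_cases hxU : (x : Arrows C) ∈ U
    · rw [char_val, Set.indicator_of_mem hxU, one_smul]
      refine char_congr _ _ (Set.Subset.antisymm (fun γ hγ => (key γ hγ).2) ?_)
      rintro _ ⟨y, hy, rfl⟩
      rw [Arrows.mem_coe_setMul, Arrows.mem_setMul_coe, Arrows.s_coe, Arrows.r_coe]
      exact ⟨⟨hO'U hxU ⟨y, (hVO hy).2, rfl⟩, hy⟩, hy⟩
    · rw [char_val, Set.indicator_of_notMem hxU, zero_smul]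
      exact char_empty _ (Set.eq_empty_of_forall_notMem fun γ hγ => hxU (key γ hγ).1)
  | zero =>
    refine ⟨Set.univ, isOpen_univ, trivial, fun V hV _ _ => ?_⟩
    change char S hV * (0 * char S hV) = (0 : S) • _
    rw [zero_mul, mul_zero, zero_smul]
  | add f g h h' =>
    obtain ⟨O, hO, hxO, h⟩ := h
    obtain ⟨O', hO', hxO', h'⟩ := h'
    refine ⟨O ∩ O', hO.inter hO', ⟨hxO, hxO'⟩, fun V hV hxV hVO => ?_⟩
    have h1 := h V hV hxV (hVO.trans Set.inter_subset_left)
    have h2 := h' V hV hxV (hVO.trans Set.inter_subset_right)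
    change _ = (f.1 x + g.1 x) • _
    rw [add_mul, mul_add, h1, h2, add_smul]
  | smul a f h =>
    obtain ⟨O, hO, hxO, h⟩ := h
    refine ⟨O, hO, hxO, fun V hV hxV hVO => ?_⟩
    have h1 := h V hV hxV hVO
    change _ = (a * f.1 x) • _
    rw [smul_mul_assoc, mul_smul_comm, h1, mul_smul]

/-! ### Congruences on the Steinberg algebra -/

/-- If a congruence identifies `1_V` with `0` for some nonempty compact open set `V` of units of a
minimal groupoid, then each unit has a compact open neighbourhood with this property. -/
theorem exists_char_rel_zero (hminimal : IsMinimalGroupoid C) (d : RingCon (SteinbergAlgebra S C))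
    {V : Set (Arrows.unitSpace C)} (hV : IsCompactOpenBisection (Subtype.val '' V))
    (hne : V.Nonempty) (h : d (char S hV) 0) (y : Arrows.unitSpace C) :
    ∃ (W : Set (Arrows.unitSpace C)) (_ : IsCompact W) (_ : IsOpen W)
      (hW : IsCompactOpenBisection (Subtype.val '' W)), y ∈ W ∧ d (char S hW) 0 := by
  -- Arbitrary bisections through `y` are allowed because the conjugate `B U B'` used for invariance
  -- need not consist of units. Multiplication by `1_W` returns to units at the end.
  let D : Set (Arrows.unitSpace C) := {y | ∃ (U : Set (Arrows C)) (hU : IsCompactOpenBisection U),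
    (y : Arrows C) ∈ U ∧ d (char S hU) 0}
  have hDo : IsOpen D := by
    rw [isOpen_iff_mem_nhds]
    rintro z ⟨U, hU, hzU, hd⟩
    exact Filter.mem_of_superset
      ((hU.isOpen.preimage continuous_subtype_val).mem_nhds hzU) fun z' hz' => ⟨U, hU, hz', hd⟩
  have hDinv : IsInvariantUnits D := by
    rintro α ⟨U, hU, hαU, hd⟩
    obtain ⟨B, hB, hαB⟩ := exists_isCompactOpenBisection_mem α
    obtain ⟨B', hB', hαB'⟩ := exists_isCompactOpenBisection_mem α.inv
    refine ⟨_, hB.setMul (hU.setMul hB'), ⟨α, hαB, α.inv, ⟨_, hαU, α.inv, hαB', rfl, ?_⟩, rfl,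
      α.comp_inv⟩, ?_⟩
    · exact α.inv.unit_comp
    · rw [← char_mul_char hB (hU.setMul hB'), ← char_mul_char hU hB']
      simpa using d.mul (d.refl (char S hB)) (d.mul hd (d.refl (char S hB')))
  have hD : D = Set.univ := by
    refine (hminimal D hDo hDinv).resolve_left fun h0 => ?_
    obtain ⟨z, hz⟩ := hne
    have : z ∈ D := ⟨_, hV, ⟨z, hz, rfl⟩, h⟩
    simp [h0] at this
  obtain ⟨U, hU, hyU, hd⟩ : y ∈ D := hD ▸ trivial
  obtain ⟨W, hWc, hWo, hyW, hWU⟩ :=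
    exists_isCompact_isOpen_units (hU.isOpen.preimage continuous_subtype_val) hyU
  have hW := isCompactOpenBisection_coe hWc hWo
  refine ⟨W, hWc, hWo, hW, hyW, ?_⟩
  rw [← char_coe_mul_char hU hW (Set.image_subset_iff.2 hWU)]
  simpa using d.mul (d.refl (char S hW)) hd

/-- If a congruence identifies `1_V` with `0` for some nonempty compact open set `V` of units of a
minimal groupoid, then it is the full one. -/
theorem eq_top_of_char_rel_zero (hminimal : IsMinimalGroupoid C)
    (d : RingCon (SteinbergAlgebra S C)) {V : Set (Arrows.unitSpace C)}
    (hV : IsCompactOpenBisection (Subtype.val '' V)) (hne : V.Nonempty)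
    (h : d (char S hV) 0) : d = ⊤ := by
  have : T2Space (Arrows.unitSpace C) := IsEtaleGroupoid.hausdorff
  have hs : IsLocalHomeomorph (Arrows.s : Arrows C → _) := IsEtaleGroupoid.isLocalHomeomorph_s
  have hcover : ∀ K : Set (Arrows.unitSpace C), IsCompact K →
      ∃ (W : Set (Arrows.unitSpace C)) (_ : IsCompact W) (_ : IsOpen W)
        (hW : IsCompactOpenBisection (Subtype.val '' W)), K ⊆ W ∧ d (char S hW) 0 := by
    intro K hK
    refine hK.induction_on ?_ ?_ ?_ ?_
    · have h0 := isCompactOpenBisection_coe (C := C) isCompact_empty isOpen_empty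
      refine ⟨∅, isCompact_empty, isOpen_empty, h0, subset_rfl, ?_⟩
      rw [char_empty h0 (Set.image_empty _)]
      exact d.refl 0
    · intro K K' hKK' h
      obtain ⟨W, hWc, hWo, hW, hKW, hd⟩ := h
      exact ⟨W, hWc, hWo, hW, hKK'.trans hKW, hd⟩
    · intro K K' h h'
      obtain ⟨W, hWc, hWo, hW, hKW, hd⟩ := h
      obtain ⟨W', hWc', hWo', hW', hKW', hd'⟩ := h'
      -- The function `1_W + 1_{W'}` is not `1_{W ∪ W'}` on the overlap, and subtraction is
      -- unavailable over a semiring, so the union is first made disjoint.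
      have hDc : IsCompact (W' \ W) := hWc'.diff hWo
      have hDo : IsOpen (W' \ W) := hWo'.sdiff hWc.isClosed
      have hD := isCompactOpenBisection_coe hDc hDo
      have hU := isCompactOpenBisection_coe (hWc.union hWc') (hWo.union hWo')
      refine ⟨W ∪ W', hWc.union hWc', hWo.union hWo', hU, Set.union_subset_union hKW hKW', ?_⟩
      have hd2 : d (char S hD) 0 := by
        rw [← char_mul_char_coe hD hW']
        · simpa using d.mul (d.refl (char S hD)) hd'
        · rintro _ ⟨y, hy, rfl⟩
          rw [Arrows.s_coe]
          exact hy.1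
      have hsum : char S hU = char S hW + char S hD := by
        refine Subtype.ext ?_
        change (Subtype.val '' (W ∪ W')).indicator (fun _ => (1 : S)) =
          (Subtype.val '' W).indicator (fun _ => 1) + (Subtype.val '' (W' \ W)).indicator fun _ => 1
        rw [← Set.union_sdiff_self, Set.image_union]
        exact Set.indicator_union_of_disjoint
          ((Set.disjoint_image_iff Subtype.val_injective).2 Set.disjoint_sdiff_right) _
      rw [hsum]
      simpa using d.add hd hd2
    · intro y hy
      obtain ⟨W, hWc, hWo, hW, hyW, hd⟩ := exists_char_rel_zero hminimal d hV hne h y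
      exact ⟨W, mem_nhdsWithin_of_mem_nhds (hWo.mem_nhds hyW), W, hWc, hWo, hW, subset_rfl, hd⟩
  -- The scalar is part of the induction because `d` is not assumed to be compatible with scalars;
  -- for a bisection, `a • 1_U = (a • 1_U) * 1_W`.
  have hzero : ∀ f : SteinbergAlgebra S C, ∀ a : S, d (a • f) 0 := by
    intro f
    induction f using induction_on with
    | char U hU =>
      intro a
      obtain ⟨W, hWc, hWo, hW, hKW, hd⟩ := hcover _ (hU.isCompact.image hs.continuous)
      rw [← char_mul_char_coe hU hW fun α hα => hKW ⟨α, hα, rfl⟩, ← smul_mul_assoc]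
      simpa using d.mul (d.refl (a • char S hU)) hd
    | zero =>
      intro a
      rw [smul_zero]
      exact d.refl 0
    | add f g h h' =>
      intro a
      rw [smul_add]
      simpa using d.add (h a) (h' a)
    | smul b f h =>
      intro a
      rw [← mul_smul]
      exact h _
  refine RingCon.ext fun f g => ⟨fun _ => trivial, fun _ => ?_⟩
  have h1 := hzero f 1
  have h2 := hzero g 1
  rw [one_smul] at h1 h2
  exact d.trans h1 (d.symm h2)

/-- A congruence that is not contained in `steinbergCon` identifies two distinct multiples of the
characteristic function of some nonempty compact open set of units. -/
theorem exists_smul_char_rel_of_not_le {d : RingCon (SteinbergAlgebra S C)}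
    (hd : ¬ d ≤ steinbergCon S C) :
    ∃ (V : Set (Arrows.unitSpace C)) (hV : IsCompactOpenBisection (Subtype.val '' V)),
      V.Nonempty ∧ ∃ a b : S, a ≠ b ∧ d (a • char S hV) (b • char S hV) := by
  obtain ⟨f, g, hfg, α, hα, hne⟩ : ∃ f g, d f g ∧ ∃ α : Arrows C,
      Arrows.s α ∈ trivialIsotropy C ∧ f.1 α ≠ g.1 α := by
    by_contra! hcon
    exact hd fun {f g} hfg α h1 _ => hcon f g hfg α h1
  -- Multiplication by `1_B` carries the values of `f` and `g` at `α` to the unit `s α`, where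
  -- corners can be cut down to multiples of `1_V`.
  obtain ⟨B, hB, hαB⟩ := exists_isCompactOpenBisection_mem α.inv
  obtain ⟨O, hO, hxO, hf⟩ := exists_open_corner_eq_smul (char S hB * f) hα
  obtain ⟨O', hO', hxO', hg⟩ := exists_open_corner_eq_smul (char S hB * g) hα
  obtain ⟨V, hVc, hVo, hxV, hVO⟩ := exists_isCompact_isOpen_units (hO.inter hO') ⟨hxO, hxO'⟩
  have hV := isCompactOpenBisection_coe hVc hVo
  refine ⟨V, hV, ⟨_, hxV⟩, f.1 α, g.1 α, hne, ?_⟩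
  rw [← char_mul_apply_s hB hαB f, ← char_mul_apply_s hB hαB g,
    ← hf V hV hxV (hVO.trans Set.inter_subset_left),
    ← hg V hV hxV (hVO.trans Set.inter_subset_right)]
  exact d.mul (d.refl _) (d.mul (d.mul (d.refl _) hfg) (d.refl _))

end SteinbergAlgebra

/-! ### Semifields -/

/-- A semifield in which `1` has an additive inverse is a field. -/
theorem Semifield.exists_field_of_one_add_eq_zero {S : Type w} [hS : Semifield S] {n : S}
    (hn : 1 + n = 0) : ∃ (F : Type w) (_ : Field F), Nonempty (S ≃+* F) := by
  let _ : Neg S := ⟨fun a => n * a⟩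
  let R : CommRing S :=
    { hS with
      zsmul := zsmulRec
      neg_add_cancel := fun a => by
        change n * a + a = 0
        rw [← add_one_mul, add_comm n, hn, zero_mul] }
  have hF : IsField S :=
    ⟨⟨0, 1, zero_ne_one⟩, mul_comm, fun {a} ha => ⟨a⁻¹, mul_inv_cancel₀ ha⟩⟩
  exact ⟨S, hF.toField, ⟨RingEquiv.refl S⟩⟩

open Classical in
/-- On a semifield in which `1` has no additive inverse, the map that sends exactly `0` to `0` is a
homomorphism onto the Boolean semifield. -/
noncomputable def Semifield.toBoolSemifield {S : Type w} [Semifield S]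
    (hS : ∀ n : S, 1 + n ≠ 0) : S →+* BoolSemifield where
  toFun a := if a = 0 then 0 else 1
  map_one' := by simp
  map_zero' := by simp
  map_mul' a b := by
    by_cases ha : a = 0 <;> by_cases hb : b = 0 <;> simp [ha, hb]
  map_add' a b := by
    by_cases ha : a = 0
    · simp [ha]
    -- Dividing `a + b = 0` by `a` would give an additive inverse of `1`.
    · have hab : a + b ≠ 0 := by
        intro h
        refine hS (a⁻¹ * b) ?_
        rw [← inv_mul_cancel₀ ha, ← mul_add, h, mul_zero]
      by_cases hb : b = 0
      · simp [ha, hb]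
      · simp only [hab, ha, hb, if_false]
        -- This is `1 = 1 + 1` in the Boolean semifield.
        rfl

/-- If `S` is a field or the Boolean semifield and `a ≠ b`, then a congruence on an `S`-algebra
that identifies `a • e` and `b • e`, for an idempotent `e`, identifies `e` and `0`. -/
theorem RingCon.rel_zero_of_smul_rel_smul {S : Type w} [Semifield S] {A : Type*}
    [NonUnitalSemiring A] [Module S A] [IsScalarTower S A A] [SMulCommClass S A A]
    (hS : (∃ (F : Type w) (_ : Field F), Nonempty (S ≃+* F)) ∨ Nonempty (S ≃+* BoolSemifield))
    (d : RingCon A) {a b : S} (hab : a ≠ b) {e : A} (he : e * e = e)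
    (h : d (a • e) (b • e)) : d e 0 := by
  -- Multiplication by `t • e` replaces scaling by `t`, since `e` is idempotent.
  have hsmul : ∀ (t : S) {x y : S}, d (x • e) (y • e) → d ((t * x) • e) ((t * y) • e) := by
    intro t x y hxy
    have := d.mul (d.refl (t • e)) hxy
    rwa [smul_mul_smul_comm, smul_mul_smul_comm, he] at this
  rcases hS with ⟨F, _, ⟨φ⟩⟩ | ⟨⟨φ⟩⟩
  -- The element `φ.symm (-φ b)` plays the role of `-b` in `S`.
  · have hb : b + φ.symm (-φ b) = 0 := φ.injective (by simp)
    have hne : a + φ.symm (-φ b) ≠ 0 := by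
      intro h0
      apply hab
      rw [← add_zero a, ← hb, add_left_comm, h0, add_zero]
    have h1 := d.add h (d.refl (φ.symm (-φ b) • e))
    rw [← add_smul, ← add_smul, hb] at h1
    have h2 := hsmul (a + φ.symm (-φ b))⁻¹ h1
    rwa [inv_mul_cancel₀ hne, mul_zero, one_smul, zero_smul] at h2
  · have h01 : ∀ t : S, t = 0 ∨ t = 1 := by
      intro t
      have : ∀ y : BoolSemifield, y = 0 ∨ y = 1
        | false => Or.inl rfl
        | true => Or.inr rfl
      exact (this (φ t)).imp (fun h => φ.injective (by simp [h])) fun h => φ.injective (by simp [h])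
    rcases h01 a with rfl | rfl <;> rcases h01 b with rfl | rfl
    · exact (hab rfl).elim
    · simpa using d.symm h
    · simpa using h
    · exact (hab rfl).elim

/-! ### Congruences on quotients -/

/-- The congruence on `R / c` induced by a congruence on `R` that contains `c`. -/
def RingCon.quotientMap {R : Type*} [Add R] [Mul R] (c d : RingCon R) (h : c ≤ d) :
    RingCon c.Quotient where
  r := Quotient.lift₂ (fun a b => d a b) fun _ _ _ _ h1 h2 =>
    propext ⟨fun h3 => d.trans (d.symm (h h1)) (d.trans h3 (h h2)),
      fun h3 => d.trans (h h1) (d.trans h3 (d.symm (h h2)))⟩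
  iseqv := by
    refine ⟨?_, ?_, ?_⟩
    · rintro ⟨a⟩
      exact d.refl a
    · rintro ⟨a⟩ ⟨b⟩ h
      exact d.symm h
    · rintro ⟨a⟩ ⟨b⟩ ⟨k⟩ h h'
      exact d.trans h h'
  add' := by
    rintro ⟨a⟩ ⟨b⟩ ⟨k⟩ ⟨l⟩ h h'
    exact d.add h h'
  mul' := by
    rintro ⟨a⟩ ⟨b⟩ ⟨k⟩ ⟨l⟩ h h'
    exact d.mul h h'

theorem RingCon.quotientMap_coe {R : Type*} [Add R] [Mul R] {c d : RingCon R} (h : c ≤ d)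
    (a b : R) : c.quotientMap d h a b ↔ d a b := Iff.rfl

/-- The quotient by `c` is congruence-simple if and only if each congruence that contains `c` is
`c` or the full one. -/
theorem isCongruenceSimple_quotient_iff {R : Type*} [NonUnitalSemiring R] (c : RingCon R) :
    IsCongruenceSimple c.Quotient ↔ ∀ d : RingCon R, c ≤ d → d = c ∨ d = ⊤ := by
  constructor
  · intro h d hcd
    rcases h (c.quotientMap d hcd) with h0 | h0
    · left
      ext a b
      rw [← RingCon.quotientMap_coe hcd, h0, RingCon.coe_bot, RingCon.eq]
    · right
      ext a b
      rw [← RingCon.quotientMap_coe hcd, h0]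
      exact ⟨fun _ => trivial, fun _ => trivial⟩
  · intro h e
    let d : RingCon R :=
      -- The pullback of `e` along the quotient map.
      { r := fun a b => e a b
        iseqv := ⟨fun a => e.refl _, e.symm, e.trans⟩
        add' := e.add
        mul' := e.mul }
    have hcd : c ≤ d := fun {a b} hab => by
      change e a b
      rw [c.eq.2 hab]
      exact e.refl _
    rcases h d hcd with h0 | h0
    · left
      ext ⟨a⟩ ⟨b⟩
      change d a b ↔ (a : c.Quotient) = b
      rw [h0, c.eq]
    · right
      ext ⟨a⟩ ⟨b⟩
      change d a b ↔ True
      rw [h0]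
      exact ⟨fun _ => trivial, fun _ => trivial⟩

/-- The congruence that identifies `f` and `g` if `φ ∘ f` and `φ ∘ g` agree on all arrows whose
source and range have trivial isotropy. -/
noncomputable def steinbergConOfHom {S : Type w} [CommSemiring S] {S' : Type*} [CommSemiring S']
    (φ : S →+* S') (C : Type u) [Groupoid.{v} C] [TopologicalSpace (Arrows C)]
    [IsAmpleGroupoid C] : RingCon (SteinbergAlgebra S C) where
  r f g := ∀ α : Arrows C, Arrows.s α ∈ trivialIsotropy C → Arrows.r α ∈ trivialIsotropy C →
    φ (f.1 α) = φ (g.1 α)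
  iseqv := ⟨fun _ _ _ _ => rfl, fun h α h1 h2 => (h α h1 h2).symm,
    fun h h' α h1 h2 => (h α h1 h2).trans (h' α h1 h2)⟩
  add' := by
    intro f f' g g' h h' α h1 h2
    change φ (f.1 α + g.1 α) = φ (f'.1 α + g'.1 α)
    rw [map_add, map_add, h α h1 h2, h' α h1 h2]
  mul' := by
    intro f f' g g' h h' γ h1 h2
    -- Finite support is what lets `φ` pass through the convolution sum.
    have hmap : ∀ k l : SteinbergAlgebra S C, φ (conv k.1 l.1 γ) =
        ∑ᶠ p : Arrows.Factorization γ, φ (k.1 p.1.1) * φ (l.1 p.1.2) := by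
      intro k l
      refine (φ.toAddMonoidHom.map_finsum (finite_support_conv k.2 l.1 γ)).trans ?_
      exact finsum_congr fun p => φ.map_mul _ _
    refine (hmap f g).trans (Eq.trans (finsum_congr ?_) (hmap f' g').symm)
    rintro ⟨⟨α, β⟩, hc, rfl⟩
    have hβ : Arrows.s β ∈ trivialIsotropy C := h1
    have hα : Arrows.r α ∈ trivialIsotropy C := h2
    exact congrArg₂ (· * ·) (h α ((trivialIsotropy_iff α).2 hα) hα)
      (h' β hβ ((trivialIsotropy_iff β).1 hβ))

/-- If the quotient by `steinbergCon` is congruence-simple, then each homomorphism from the scalars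
to a nontrivial semiring is injective. -/
theorem injective_of_isCongruenceSimple {C : Type u} [Groupoid.{v} C]
    [TopologicalSpace (Arrows C)] [IsAmpleGroupoid C] [Nonempty C]
    (hprincipal : IsTopologicallyPrincipal C) {S : Type w} [CommSemiring S] {S' : Type*}
    [CommSemiring S'] [Nontrivial S'] (φ : S →+* S')
    (h : IsCongruenceSimple (steinbergCon S C).Quotient) : Function.Injective φ := by
  have : Nonempty (Arrows.unitSpace C) := ⟨Arrows.s (Arrows.unit (Classical.arbitrary C))⟩
  obtain ⟨x, hx⟩ := hprincipal.nonempty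
  obtain ⟨V, hVc, hVo, hxV, -⟩ := exists_isCompact_isOpen_units isOpen_univ (Set.mem_univ x)
  have hV := isCompactOpenBisection_coe hVc hVo
  have hval : ∀ a : S, (a • SteinbergAlgebra.char S hV).1 x = a := by
    intro a
    change a * (SteinbergAlgebra.char S hV).1 x = a
    rw [SteinbergAlgebra.char_val, Set.indicator_of_mem (Set.mem_image_of_mem _ hxV), mul_one]
  have hsx : Arrows.s (x : Arrows C) ∈ trivialIsotropy C := (Arrows.s_coe x).symm ▸ hx
  have hrx : Arrows.r (x : Arrows C) ∈ trivialIsotropy C := (Arrows.r_coe x).symm ▸ hx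
  -- Evaluating multiples of `1_V` at `x` recovers the scalar. If the congruence is `≡`, then `φ a =
  -- φ b` gives `a = b`; if it is full, then `φ 1 = φ 0`, which is impossible.
  rcases (isCongruenceSimple_quotient_iff _).1 h (steinbergConOfHom φ C)
    fun {f g} hfg α h1 h2 => congrArg φ (hfg α h1 h2) with h0 | h0
  · intro a b hab
    have h1 : steinbergConOfHom φ C (a • SteinbergAlgebra.char S hV)
        (b • SteinbergAlgebra.char S hV) := by
      intro α _ _
      change φ (a * (SteinbergAlgebra.char S hV).1 α) = φ (b * (SteinbergAlgebra.char S hV).1 α)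
      rw [map_mul, map_mul, hab]
    rw [h0] at h1
    have h2 := h1 x hsx hrx
    rwa [hval, hval] at h2
  · have h1 : steinbergConOfHom φ C ((1 : S) • SteinbergAlgebra.char S hV)
        ((0 : S) • SteinbergAlgebra.char S hV) := by
      rw [h0]
      trivial
    have h2 := h1 x hsx hrx
    rw [hval, hval, map_one, map_zero] at h2
    exact (one_ne_zero h2).elim

/-! ### The characterization of congruence-simplicity -/

theorem proposition3p6 {C : Type u} [Groupoid.{v} C] [TopologicalSpace (Arrows C)]
    [IsAmpleGroupoid C] [Nonempty C] (hprincipal : IsTopologicallyPrincipal C)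
    (hminimal : IsMinimalGroupoid C) (S : Type w) [Semifield S] :
    IsCongruenceSimple (steinbergCon S C).Quotient ↔
      (∃ (F : Type w) (_ : Field F), Nonempty (S ≃+* F)) ∨ Nonempty (S ≃+* BoolSemifield) := by
  constructor
  · intro h
    -- Either `S` has negatives, or it maps onto the Boolean semifield with only `0` going to `0`.
    by_cases hS : ∃ n : S, 1 + n = 0
    · obtain ⟨n, hn⟩ := hS
      exact Or.inl (Semifield.exists_field_of_one_add_eq_zero hn)
    · let φ := Semifield.toBoolSemifield (not_exists.1 hS)
      refine Or.inr ⟨RingEquiv.ofBijective φ ⟨injective_of_isCongruenceSimple hprincipal φ h, ?_⟩⟩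
      rintro (_ | _)
      · exact ⟨0, map_zero φ⟩
      · exact ⟨1, map_one φ⟩
  · intro hS
    rw [isCongruenceSimple_quotient_iff]
    intro d hd
    by_cases hle : d ≤ steinbergCon S C
    · exact Or.inl (le_antisymm hle hd)
    · obtain ⟨V, hV, hne, a, b, hab, h⟩ := SteinbergAlgebra.exists_smul_char_rel_of_not_le hle
      refine Or.inr (SteinbergAlgebra.eq_top_of_char_rel_zero hminimal d hV hne ?_)
      exact d.rel_zero_of_smul_rel_smul hS hab
        (SteinbergAlgebra.char_coe_mul_char hV hV subset_rfl) h
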